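/- Let $(\mathcal C,J)$ and $(\mathcal D,K)$ be locally small, small-generated sites (each has a small full subcategory from which every object is covered), with Grothendieck topologies $J$, $K$, and let $f:\mathcal C\to\mathcal D$ be a functor which is both * a morphism of sites $(\mathcal C,J)\to(\mathcal D,K)$: it sends $J$-covers to $K$-covers, and for every finite diagram $X:I\to\mathcal C$ and every cone on $fX$ with vertex $d$, the arrows $w:d'\to d$ along which the restricted cone factors through the $f$-image of some cone on $X$ form a $K$-covering sieve of $d$; and * a comorphism of sites: for every $c$ and every $K$-covering sieve $S$ of $f(c)$ the sieve $\{u:c'\to c\mid f(u)\in S\}$ is $J$-covering. Let $\mathrm{Sh}(f):\mathrm{Sh}(\mathcal D,K)\to\mathrm{Sh}(\mathcal C,J)$ be the geometric morphism whose direct image $\mathrm{Sh}(f)_*$ is restriction along $f$, and let $C_f:\mathrm{Sh}(\mathcal C,J)\to\mathrm{Sh}(\mathcal D,K)$ be the geometric morphism whose inverse image is restriction along $f$ followed by $J$-sheafification. Consider a square $\varphi: k t\Rightarrow h G$ of functors between small-generated sites, $t:(\mathcal A,M)\to(\mathcal B,L)$, $h:(\mathcal C',J')\to(\mathcal D',K')$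 morphisms of sites and $G:(\mathcal A,M)\to(\mathcal C',J')$, $k:(\mathcal B,L)\to(\mathcal D',K')$ comorphisms of sites. Restriction along $\varphi$ induces a 2-cell $C_G^*\,\mathrm{Sh}(h)_*\Rightarrow \mathrm{Sh}(t)_*\,C_k^*$, whose mate is a 2-cell $\mathrm{Sh}(t)^*\,C_G^*\Rightarrow C_k^*\,\mathrm{Sh}(h)^*$; the square is called ($L$-)locally exact if this last 2-cell is invertible. A geometric morphism $p:\mathcal E\to\mathcal F$ is totally connected if $p^*$ has an $\mathcal F$-indexed left adjoint $p_!$ (that is, $p$ is locally connected) and $p_!$ preserves finite limits. A section of $p$ is a geometric morphism $s:\mathcal F\to\mathcal E$ with an isomorphism $s^*p^*\cong 1$; morphisms of sections $s\to s'$ are natural transformations $s^*\Rightarrow s'^*$ compatible with these isomorphisms. Then $C_f$ is totally connected if and only if the identity square of $f$ $$\begin{array}{ccc}(\mathcal C,J)&\xrightarrow{\ f\ }&(\mathcal D,K)\\ {\scriptstyle f}\downarrow&&\|\\ (\mathcal D,K)&=&(\mathcal D,K)\end{array}$$ (with $t=G=f$, $h=k=1_{\mathcal D}$, $\varphi=1$)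 is $K$-locally exact. Moreover, in that case $\mathrm{Sh}(f)$ is a terminal section of $C_f$: for some isomorphism $\mathrm{Sh}(f)^*C_f^*\cong 1$ it is a terminal object of the category of sections of $C_f$. -/

import Mathlib

open CategoryTheory Limits Opposite

universe w u₁ u₂ u₃ u₄

namespace SiteTopos

/-- A (locally small) site is *small-generated* if it has a small full dense subcategory: every
object of `C` is covered by objects of `C₀`. -/
class IsSmallGenerated {C : Type u₁} [Category.{w} C] (J : GrothendieckTopology C) : Prop where
  exists_dense : ∃ (C₀ : Type w) (_ : SmallCategory C₀) (i : C₀ ⥤ C),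
    i.Full ∧ i.Faithful ∧ i.IsCoverDense J

theorem IsSmallGenerated.hasSheafify {C : Type u₁} [Category.{w} C] (J : GrothendieckTopology C)
    [IsSmallGenerated J] : HasSheafify J (Type w) := by
  obtain ⟨C₀, _, i, _, _, _⟩ := IsSmallGenerated.exists_dense (J := J)
  exact Functor.IsDenseSubsite.hasSheafify_of_isEquivalence (A := Type w) (i.restrictedTopology J) J i

attribute [instance] IsSmallGenerated.hasSheafify

variable {C : Type u₁} [Category.{w} C] {D : Type u₂} [Category.{w} D]

/-- For a cone `c` over the image under `f` of a diagram `X` in `C`, with vertex `c.pt` in `D`, the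
sieve on `c.pt` of those arrows `w : d' ⟶ c.pt` such that the cone `w ≫ c` factors through the
`f`-image of some cone over `X`. -/
def factorSieve {I : Type} [SmallCategory I] (f : C ⥤ D) {X : I ⥤ C} (c : Cone (X ⋙ f)) :
    Sieve c.pt where
  arrows d' w := ∃ (a : Cone X) (u : d' ⟶ f.obj a.pt),
    ∀ i, u ≫ f.map (a.π.app i) = w ≫ c.π.app i
  downward_closed := by
    rintro d' d'' w ⟨a, u, h⟩ v
    exact ⟨a, v ≫ u, fun i => by rw [Category.assoc, h, Category.assoc]⟩

/-- `f` is a *morphism of sites* `(C, J) → (D, K)`: it is `K`-flat (covering-flat), i.e. every cone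
over the `f`-image of a finite diagram factors, `K`-locally, through `f`-images of cones over the
diagram, and it sends `J`-covers to `K`-covers. (A *comorphism of sites* is a cover-lifting functor,
`Functor.IsCocontinuous`.) -/
class IsMorphismOfSites (J : GrothendieckTopology C) (K : GrothendieckTopology D) (f : C ⥤ D) : Prop where
  factorSieve_mem : ∀ (I : Type) [SmallCategory I] [FinCategory I] (X : I ⥤ C)
    (c : Cone (X ⋙ f)), factorSieve f c ∈ K c.pt
  coverPreserving : CoverPreserving J K f

variable (J : GrothendieckTopology C) (K : GrothendieckTopology D) (f : C ⥤ D)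

instance : IsMorphismOfSites J J (𝟭 C) where
  factorSieve_mem I _ _ X c := by
    convert J.top_mem c.pt
    ext d' w
    simp only [Sieve.top_apply, iff_true]
    refine ⟨⟨c.pt, c.π⟩, w, fun i => rfl⟩
  coverPreserving := idCoverPreserving J

theorem nonempty_mem [IsMorphismOfSites J K f] (d : D) :
    ∃ S ∈ K d, ∀ ⦃d' : D⦄ (w : d' ⟶ d), S w → ∃ (c : C), Nonempty (d' ⟶ f.obj c) := by
  let cn : Cone (Functor.empty.{0} C ⋙ f) := ⟨d, ⟨fun x => x.as.elim, fun x => x.as.elim⟩⟩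
  refine ⟨_, IsMorphismOfSites.factorSieve_mem J _ _ cn, ?_⟩
  rintro d' w ⟨t, v, h⟩
  exact ⟨t.pt, ⟨v⟩⟩

theorem cospan_mem [IsMorphismOfSites J K f] {d : D} {c c' z : C} (u : d ⟶ f.obj c)
    (u' : d ⟶ f.obj c') (a : c ⟶ z) (b : c' ⟶ z) (hu : u ≫ f.map a = u' ≫ f.map b) :
    ∃ S ∈ K d, ∀ ⦃d' : D⦄ (w : d' ⟶ d), S w → ∃ (c'' : C) (p : c'' ⟶ c) (q : c'' ⟶ c')
      (v : d' ⟶ f.obj c''), v ≫ f.map p = w ≫ u ∧ v ≫ f.map q = w ≫ u' ∧ p ≫ a = q ≫ b := by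
  let cn : Cone (cospan a b ⋙ f) :=
    (Cone.postcompose (diagramIsoCospan (cospan a b ⋙ f)).inv).obj (PullbackCone.mk u u' hu)
  refine ⟨_, IsMorphismOfSites.factorSieve_mem J _ _ cn, ?_⟩
  rintro d' w ⟨t, v, h⟩
  have h1 : v ≫ f.map (t.π.app .left) = w ≫ u ≫ 𝟙 _ := h .left
  have h2 : v ≫ f.map (t.π.app .right) = w ≫ u' ≫ 𝟙 _ := h .right
  have h3 : t.π.app .left ≫ a = t.π.app .one := t.w WalkingCospan.Hom.inl
  have h4 : t.π.app .right ≫ b = t.π.app .one := t.w WalkingCospan.Hom.inr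
  exact ⟨t.pt, t.π.app .left, t.π.app .right, v, by simpa using! h1, by simpa using! h2,
    h3.trans h4.symm⟩

theorem pair_mem [IsMorphismOfSites J K f] {d : D} {c c' : C} (u : d ⟶ f.obj c)
    (u' : d ⟶ f.obj c') :
    ∃ S ∈ K d, ∀ ⦃d' : D⦄ (w : d' ⟶ d), S w → ∃ (c'' : C) (a : c'' ⟶ c) (b : c'' ⟶ c')
      (v : d' ⟶ f.obj c''), v ≫ f.map a = w ≫ u ∧ v ≫ f.map b = w ≫ u' := by
  let cn : Cone (pair c c' ⋙ f) := (Cone.postcompose (mapPairIso (Iso.refl _) (Iso.refl _) :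
    pair (f.obj c) (f.obj c') ≅ pair c c' ⋙ f).hom).obj (BinaryFan.mk u u')
  refine ⟨_, IsMorphismOfSites.factorSieve_mem J _ _ cn, ?_⟩
  rintro d' w ⟨a, v, h⟩
  have h1 : v ≫ f.map (a.π.app ⟨.left⟩) = w ≫ u ≫ 𝟙 _ := h ⟨.left⟩
  have h2 : v ≫ f.map (a.π.app ⟨.right⟩) = w ≫ u' ≫ 𝟙 _ := h ⟨.right⟩
  exact ⟨a.pt, a.π.app ⟨.left⟩, a.π.app ⟨.right⟩, v, by simpa using! h1, by simpa using! h2⟩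

theorem equalizer_mem [IsMorphismOfSites J K f] {d : D} {c c' : C} (u : d ⟶ f.obj c)
    (a b : c ⟶ c') (hu : u ≫ f.map a = u ≫ f.map b) :
    ∃ S ∈ K d, ∀ ⦃d' : D⦄ (w : d' ⟶ d), S w → ∃ (c'' : C) (e : c'' ⟶ c)
      (v : d' ⟶ f.obj c''), v ≫ f.map e = w ≫ u ∧ e ≫ a = e ≫ b := by
  let cn : Cone (parallelPair a b ⋙ f) :=
    (Cone.postcompose (diagramIsoParallelPair (parallelPair a b ⋙ f)).inv).obj (Fork.ofι u hu)
  refine ⟨_, IsMorphismOfSites.factorSieve_mem J _ _ cn, ?_⟩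
  rintro d' w ⟨t, v, h⟩
  have h1 : v ≫ f.map (t.π.app .zero) = w ≫ u ≫ 𝟙 _ := h .zero
  have h3 : t.π.app .zero ≫ a = t.π.app .one := t.w WalkingParallelPairHom.left
  have h4 : t.π.app .zero ≫ b = t.π.app .one := t.w WalkingParallelPairHom.right
  exact ⟨t.pt, t.π.app .zero, v, by simpa using! h1, h3.trans h4.symm⟩

/-- Restriction along a morphism of sites sends sheaves to sheaves. -/
theorem isContinuous [IsMorphismOfSites J K f] : f.IsContinuous J K := by
  refine Functor.isContinuous_of_coverPreserving ⟨?_⟩ (IsMorphismOfSites.coverPreserving)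
  intro ℱ Z T x hx Y₁ Y₂ X f₁ f₂ g₁ g₂ hg₁ hg₂ e
  obtain ⟨S, hS, h⟩ := cospan_mem J K f f₁ f₂ g₁ g₂ e
  apply (((isSheaf_iff_isSheaf_of_type _ _).1 ℱ.2).isSeparated _ hS).ext
  intro d' w hw
  obtain ⟨c'', p, q, v, hp, hq, hpq⟩ := h w hw
  rw [← Functor.map_comp_apply, ← Functor.map_comp_apply, ← op_comp, ← op_comp, ← hp, ← hq]
  have := hx p q hg₁ hg₂ hpq
  simp only [op_comp, Functor.map_comp_apply]
  exact congrArg _ this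

attribute [instance] isContinuous


section Lan

variable {C₀ : Type w} [SmallCategory C₀] (g : C₀ ⥤ D)

/-- The element of the left Kan extension of `X` along `g.op` represented by `u : d ⟶ g c` and
`x ∈ X c`. -/
noncomputable def el (X : C₀ᵒᵖ ⥤ Type w) {d : D} {c : C₀} (u : d ⟶ g.obj c) (x : X.obj (op c)) :
    (g.op.lan.obj X).obj (op d) :=
  (g.op.lan.obj X).map u.op ((g.op.lanUnit.app X).app (op c) x)

theorem el_map (X : C₀ᵒᵖ ⥤ Type w) {d d' : D} (w : d' ⟶ d) {c : C₀} (u : d ⟶ g.obj c)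
    (x : X.obj (op c)) : (g.op.lan.obj X).map w.op (el g X u x) = el g X (w ≫ u) x := by
  simp [el]

theorem el_res (X : C₀ᵒᵖ ⥤ Type w) {d : D} {c c' : C₀} (u : d ⟶ g.obj c') (a : c' ⟶ c)
    (x : X.obj (op c)) : el g X (u ≫ g.map a) x = el g X u (X.map a.op x) := by
  have h : (g.op.lanUnit.app X).app (op c') (X.map a.op x) =
      (g.op.lan.obj X).map (g.map a).op ((g.op.lanUnit.app X).app (op c) x) :=
    NatTrans.naturality_apply (g.op.lanUnit.app X) a.op x
  simp [el, h]

theorem el_nat {X Y : C₀ᵒᵖ ⥤ Type w} (φ : X ⟶ Y) {d : D} {c : C₀} (u : d ⟶ g.obj c)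
    (x : X.obj (op c)) : (g.op.lan.map φ).app _ (el g X u x) = el g Y u (φ.app _ x) := by
  have h1 := congr_arg (fun t => t.app (op c) x) (g.op.lanUnit.naturality φ)
  simp only [el]
  rw [NatTrans.naturality_apply]
  congr 1
  exact h1.symm

theorem el_surj (X : C₀ᵒᵖ ⥤ Type w) {d : D} (p : (g.op.lan.obj X).obj (op d)) :
    ∃ (c : C₀) (u : d ⟶ g.obj c) (x : X.obj (op c)), el g X u x = p := by
  obtain ⟨j, x, h⟩ := Types.jointly_surjective_of_isColimit
    (g.op.isPointwiseLeftKanExtensionLeftKanExtensionUnit X (op d)) p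
  exact ⟨j.left.unop, j.hom.unop, x, h⟩


/-- Two representatives are locally identified by a common refinement. -/
def LocRel (X : C₀ᵒᵖ ⥤ Type w) {d : D} (p q : Σ c : C₀, (d ⟶ g.obj c) × X.obj (op c)) : Prop :=
  ∃ S ∈ K d, ∀ ⦃d' : D⦄ (w : d' ⟶ d), S w → ∃ (c : C₀) (a : c ⟶ p.1) (b : c ⟶ q.1)
    (v : d' ⟶ g.obj c), v ≫ g.map a = w ≫ p.2.1 ∧ v ≫ g.map b = w ≫ q.2.1 ∧
      X.map a.op p.2.2 = X.map b.op q.2.2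

theorem locRel_equivalence (J₀ : GrothendieckTopology C₀) [IsMorphismOfSites J₀ K g]
    (X : C₀ᵒᵖ ⥤ Type w) (d : D) :
    Equivalence (LocRel K g X (d := d)) where
  refl p := ⟨⊤, K.top_mem _, fun d' w _ => ⟨p.1, 𝟙 _, 𝟙 _, w ≫ p.2.1, by simp, by simp, rfl⟩⟩
  symm := by
    rintro p q ⟨S, hS, h⟩
    refine ⟨S, hS, fun d' w hw => ?_⟩
    obtain ⟨c, a, b, v, h1, h2, h3⟩ := h w hw
    exact ⟨c, b, a, v, h2, h1, h3.symm⟩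
  trans := by
    rintro p q r ⟨S, hS, h⟩ ⟨T, hT, h'⟩
    let R : Sieve d :=
      { arrows := fun d' w => ∃ (c : C₀) (a : c ⟶ p.1) (b : c ⟶ r.1)
          (v : d' ⟶ g.obj c), v ≫ g.map a = w ≫ p.2.1 ∧ v ≫ g.map b = w ≫ r.2.1 ∧
          X.map a.op p.2.2 = X.map b.op r.2.2
        downward_closed := by
          rintro d' d'' w ⟨c, a, b, v, h1, h2, h3⟩ u
          exact ⟨c, a, b, u ≫ v, by simp [h1], by simp [h2], h3⟩ }
    refine ⟨R, ?_, fun _ _ hw => hw⟩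
    refine K.transitive (K.intersection_covering hS hT) R ?_
    rintro d' w ⟨hw, hw'⟩
    obtain ⟨c, a, b, v, h1, h2, h3⟩ := h w hw
    obtain ⟨c', a', b', v', h1', h2', h3'⟩ := h' w hw'
    obtain ⟨U, hU, hh⟩ := cospan_mem J₀ K g v v' b a' (h2.trans h1'.symm)
    refine K.superset_covering ?_ hU
    intro d'' w' hw''
    obtain ⟨c'', s, t, v'', e1, e2, e3⟩ := hh w' hw''
    refine ⟨c'', s ≫ a, t ≫ b', v'', ?_, ?_, ?_⟩
    · rw [g.map_comp, ← Category.assoc, e1, Category.assoc, h1, Category.assoc]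
    · rw [g.map_comp, ← Category.assoc, e2, Category.assoc, h2', Category.assoc]
    · have e4 : X.map s.op (X.map b.op q.2.2) = X.map t.op (X.map a'.op q.2.2) := by
        rw [← Functor.map_comp_apply, ← Functor.map_comp_apply, ← op_comp, ← op_comp, e3]
      simp only [op_comp, Functor.map_comp_apply, h3, ← h3', e4]

theorem el_eq (J₀ : GrothendieckTopology C₀) [IsMorphismOfSites J₀ K g]
    (X : C₀ᵒᵖ ⥤ Type w) {d : D} {c c' : C₀} (u : d ⟶ g.obj c) (x : X.obj (op c))
    (u' : d ⟶ g.obj c') (x' : X.obj (op c')) (h : el g X u x = el g X u' x') :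
    LocRel K g X ⟨c, u, x⟩ ⟨c', u', x'⟩ := by
  let st : Setoid (Σ c : C₀, (d ⟶ g.obj c) × X.obj (op c)) :=
    ⟨LocRel K g X, locRel_equivalence K g J₀ X d⟩
  let hc := g.op.isPointwiseLeftKanExtensionLeftKanExtensionUnit X (op d)
  let cc : Cocone (CostructuredArrow.proj g.op (op d) ⋙ X) :=
    { pt := Quotient st
      ι :=
        { app := fun j => ↾(fun x => Quotient.mk st ⟨j.left.unop, j.hom.unop, x⟩)
          naturality := by
            intro j j' φ
            ext y
            refine Quotient.sound ?_
            refine ⟨⊤, K.top_mem _, fun d' w _ => ⟨j'.left.unop, 𝟙 _, φ.left.unop,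
              w ≫ j'.hom.unop, by simp, ?_, by simp; rfl⟩⟩
            have := CostructuredArrow.w φ
            have h2 : j'.hom.unop ≫ g.map φ.left.unop = j.hom.unop := by
              rw [← this]; rfl
            simp [h2] } }
  have key : ∀ (c : C₀) (u : d ⟶ g.obj c) (x : X.obj (op c)),
      hc.desc cc (el g X u x) = Quotient.mk st ⟨c, u, x⟩ := by
    intro c u x
    exact congr_arg (fun t => t x) (hc.fac cc (CostructuredArrow.mk (Y := op c) u.op))
  exact Quotient.exact ((key c u x).symm.trans ((congr_arg _ h).trans (key c' u' x')))


/-- Sheafification inverts locally bijective maps, on a small-generated site. -/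
theorem isIso_presheafToSheaf_map [IsSmallGenerated K] {P Q : Dᵒᵖ ⥤ Type w} (φ : P ⟶ Q)
    (hinj : Presheaf.IsLocallyInjective K φ) (hsurj : Presheaf.IsLocallySurjective K φ) :
    IsIso ((presheafToSheaf K (Type w)).map φ) := by
  obtain ⟨D₀, _, i, _, _, _⟩ := IsSmallGenerated.exists_dense (J := K)
  let K₀ := i.restrictedTopology K
  have h1 : Presheaf.IsLocallyInjective K₀ (Functor.whiskerLeft i.op φ) :=
    Presheaf.isLocallyInjective_whisker (J := K₀) (K := K) (H := i) (f := φ)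
  have h2 : Presheaf.IsLocallySurjective K₀ (Functor.whiskerLeft i.op φ) :=
    Presheaf.isLocallySurjective_whisker (J := K₀) (K := K) (H := i) (f := φ)
  have h3 : K₀.W (Functor.whiskerLeft i.op φ) := K₀.W_of_isLocallyBijective _
  rw [GrothendieckTopology.W_iff] at h3
  have h4 : IsIso ((Functor.IsDenseSubsite.sheafEquiv K₀ K i (Type w)).inverse.map
      ((presheafToSheaf K (Type w)).map φ)) := (NatIso.isIso_map_iff
    (Functor.IsDenseSubsite.sheafEquivSheafificationCompatibility K₀ K i (Type w)) φ).1 h3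
  exact isIso_of_reflects_iso _ (Functor.IsDenseSubsite.sheafEquiv K₀ K i (Type w)).inverse

theorem preservesTerminal (J₀ : GrothendieckTopology C₀) [IsMorphismOfSites J₀ K g]
    [IsSmallGenerated K] :
    PreservesLimit (Functor.empty.{0} (C₀ᵒᵖ ⥤ Type w)) (g.op.lan ⋙ presheafToSheaf K (Type w)) := by
  have sub : ∀ (X : C₀ᵒᵖ) (x y : (⊤_ (C₀ᵒᵖ ⥤ Type w)).obj X), x = y := by
    intro X x y
    have h : IsTerminal (((evaluation _ _).obj X).obj (⊤_ (C₀ᵒᵖ ⥤ Type w))) :=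
      IsTerminal.isTerminalObj _ _ terminalIsTerminal
    exact congr_arg (fun t => t PUnit.unit) (h.hom_ext (↾fun _ : PUnit => x) (↾fun _ => y))
  have sub' : ∀ (X : Dᵒᵖ) (x y : (⊤_ (Dᵒᵖ ⥤ Type w)).obj X), x = y := by
    intro X x y
    have h : IsTerminal (((evaluation _ _).obj X).obj (⊤_ (Dᵒᵖ ⥤ Type w))) :=
      IsTerminal.isTerminalObj _ _ terminalIsTerminal
    exact congr_arg (fun t => t PUnit.unit) (h.hom_ext (↾fun _ : PUnit => x) (↾fun _ => y))
  have ne : ∀ (X : C₀ᵒᵖ), Nonempty ((⊤_ (C₀ᵒᵖ ⥤ Type w)).obj X) := fun X =>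
    ⟨(terminal.from ((Functor.const _).obj PUnit)).app X PUnit.unit⟩
  have : IsIso ((presheafToSheaf K (Type w)).map (terminal.from (g.op.lan.obj (⊤_ _)))) := by
    apply isIso_presheafToSheaf_map
    · refine ⟨fun {X} p q _ => ?_⟩
      obtain ⟨c, u, x, rfl⟩ := el_surj g _ p
      obtain ⟨c', u', x', rfl⟩ := el_surj g _ q
      obtain ⟨S, hS, h⟩ := pair_mem J₀ K g u u'
      refine K.superset_covering ?_ hS
      intro d' w hw
      obtain ⟨c'', a, b, v, h1, h2⟩ := h w hw
      rw [Presheaf.equalizerSieve_apply]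
      rw [el_map, el_map, ← h1, ← h2, el_res, el_res]
      congr 1
      apply sub
    · refine ⟨fun {X} s => ?_⟩
      obtain ⟨S, hS, h⟩ := nonempty_mem J₀ K g X
      refine K.superset_covering ?_ hS
      intro d' w hw
      obtain ⟨c, ⟨v⟩⟩ := h w hw
      exact ⟨el g _ v (ne (op c)).some, sub' _ _ _⟩
  have := PreservesTerminal.iso (presheafToSheaf K (Type w))
  refine preservesTerminal_of_iso _ ?_
  exact asIso ((presheafToSheaf K (Type w)).map (terminal.from (g.op.lan.obj (⊤_ _)))) ≪≫
    PreservesTerminal.iso (presheafToSheaf K (Type w))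

theorem isIso_map_pullbackComparison (J₀ : GrothendieckTopology C₀) [IsMorphismOfSites J₀ K g]
    [IsSmallGenerated K] {X Y Z : C₀ᵒᵖ ⥤ Type w}
    (φ : X ⟶ Z) (ψ : Y ⟶ Z) :
    IsIso ((presheafToSheaf K (Type w)).map (pullbackComparison g.op.lan φ ψ)) := by
  have hpb := fun c => (IsPullback.of_hasPullback φ ψ).map ((evaluation _ (Type w)).obj c)
  have hpb' := fun d => (IsPullback.of_hasPullback (g.op.lan.map φ) (g.op.lan.map ψ)).map
    ((evaluation _ (Type w)).obj d)
  have hfst : ∀ {d : D} {c : C₀} (u : d ⟶ g.obj c) (z : (pullback φ ψ).obj (op c)),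
      (pullback.fst (g.op.lan.map φ) (g.op.lan.map ψ)).app _
        ((pullbackComparison g.op.lan φ ψ).app _ (el g _ u z)) =
      el g X u ((pullback.fst φ ψ).app _ z) := by
    intro d c u z
    rw [← el_nat]
    exact congr_arg (fun t => t.app _ (el g _ u z)) (pullbackComparison_comp_fst g.op.lan φ ψ)
  have hsnd : ∀ {d : D} {c : C₀} (u : d ⟶ g.obj c) (z : (pullback φ ψ).obj (op c)),
      (pullback.snd (g.op.lan.map φ) (g.op.lan.map ψ)).app _
        ((pullbackComparison g.op.lan φ ψ).app _ (el g _ u z)) =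
      el g Y u ((pullback.snd φ ψ).app _ z) := by
    intro d c u z
    rw [← el_nat]
    exact congr_arg (fun t => t.app _ (el g _ u z)) (pullbackComparison_comp_snd g.op.lan φ ψ)
  apply isIso_presheafToSheaf_map
  · refine ⟨fun {d} p q hpq => ?_⟩
    obtain ⟨c, u, x, rfl⟩ := el_surj g _ p
    obtain ⟨c', u', x', rfl⟩ := el_surj g _ q
    have e1 := congr_arg ((pullback.fst (g.op.lan.map φ) (g.op.lan.map ψ)).app _) hpq
    have e2 := congr_arg ((pullback.snd (g.op.lan.map φ) (g.op.lan.map ψ)).app _) hpq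
    rw [hfst, hfst] at e1
    rw [hsnd, hsnd] at e2
    obtain ⟨S, hS, h⟩ := el_eq K g J₀ X _ _ _ _ e1
    obtain ⟨T, hT, h'⟩ := el_eq K g J₀ Y _ _ _ _ e2
    refine K.transitive (K.intersection_covering hS hT) _ ?_
    rintro d' w ⟨hw, hw'⟩
    obtain ⟨c₁, a₁, b₁, v₁, i1, i2, i3⟩ := h w hw
    obtain ⟨c₂, a₂, b₂, v₂, j1, j2, j3⟩ := h' w hw'
    obtain ⟨U, hU, k⟩ := cospan_mem J₀ K g v₁ v₂ a₁ a₂ (i1.trans j1.symm)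
    refine K.transitive hU _ ?_
    intro d'' w' hw''
    obtain ⟨c₃, s, t, v₃, k1, k2, k3⟩ := k w' hw''
    obtain ⟨V, hV, l⟩ := equalizer_mem J₀ K g v₃ (s ≫ b₁) (t ≫ b₂) (by
      rw [g.map_comp, g.map_comp, ← Category.assoc, ← Category.assoc, k1, k2, Category.assoc,
        Category.assoc, i2, j2])
    refine K.superset_covering ?_ hV
    intro d₃ w₃ hw₃
    obtain ⟨c₄, e, v₄, l1, l2⟩ := l w₃ hw₃
    simp only [Sieve.pullback_apply, Presheaf.equalizerSieve_apply, Category.assoc]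
    have m1 : (w₃ ≫ w' ≫ w) ≫ u = v₄ ≫ g.map (e ≫ s ≫ a₁) := by
      rw [g.map_comp, g.map_comp, reassoc_of% l1, reassoc_of% k1, i1]
      simp
    have m2 : (w₃ ≫ w' ≫ w) ≫ u' = v₄ ≫ g.map (e ≫ s ≫ b₁) := by
      rw [g.map_comp, g.map_comp, reassoc_of% l1, reassoc_of% k1, i2]
      simp
    rw [el_map, el_map, m1, m2, el_res, el_res]
    congr 1
    apply Types.ext_of_isPullback (hpb (op c₄))
    · change (pullback.fst φ ψ).app _ _ = (pullback.fst φ ψ).app _ _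
      rw [NatTrans.naturality_apply, NatTrans.naturality_apply]
      dsimp only at i3
      simp only [op_comp, Functor.map_comp_apply, i3]
    · change (pullback.snd φ ψ).app _ _ = (pullback.snd φ ψ).app _ _
      rw [NatTrans.naturality_apply, NatTrans.naturality_apply]
      dsimp only at j3
      rw [k3, l2]
      simp only [op_comp, Functor.map_comp_apply, j3]
  · refine ⟨fun {d} s => ?_⟩
    obtain ⟨c, u, x, hx⟩ := el_surj g _ ((pullback.fst (g.op.lan.map φ) (g.op.lan.map ψ)).app _ s)
    obtain ⟨c', u', y, hy⟩ := el_surj g _ ((pullback.snd (g.op.lan.map φ) (g.op.lan.map ψ)).app _ s)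
    have hs : (g.op.lan.map φ).app _ (el g X u x) = (g.op.lan.map ψ).app _ (el g Y u' y) := by
      rw [hx, hy]
      exact congr_arg (fun t => t.app _ s)
        (pullback.condition (f := g.op.lan.map φ) (g := g.op.lan.map ψ))
    rw [el_nat, el_nat] at hs
    obtain ⟨S, hS, h⟩ := el_eq K g J₀ Z _ _ _ _ hs
    refine K.superset_covering ?_ hS
    intro d' w hw
    obtain ⟨c₁, a, b, v, i1, i2, i3⟩ := h w hw
    obtain ⟨z, hz1, hz2⟩ := Types.exists_of_isPullback (hpb (op c₁)) (X.map a.op x) (Y.map b.op y)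
      (by
        change φ.app _ _ = ψ.app _ _
        rw [NatTrans.naturality_apply, NatTrans.naturality_apply]
        exact i3)
    refine ⟨el g _ v z, ?_⟩
    apply Types.ext_of_isPullback (hpb' (op d'))
    · refine (hfst v z).trans ?_
      change _ = (pullback.fst (g.op.lan.map φ) (g.op.lan.map ψ)).app _ _
      rw [NatTrans.naturality_apply, ← hx, el_map, ← i1, el_res]
      exact congr_arg _ hz1
    · refine (hsnd v z).trans ?_
      change _ = (pullback.snd (g.op.lan.map φ) (g.op.lan.map ψ)).app _ _
      rw [NatTrans.naturality_apply, ← hy, el_map, ← i2, el_res]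
      exact congr_arg _ hz2

theorem preservesPullback (J₀ : GrothendieckTopology C₀) [IsMorphismOfSites J₀ K g]
    [IsSmallGenerated K] :
    PreservesLimitsOfShape WalkingCospan (g.op.lan ⋙ presheafToSheaf K (Type w)) := by
  refine ⟨fun {F} => ?_⟩
  suffices h : PreservesLimit (cospan (F.map WalkingCospan.Hom.inl) (F.map WalkingCospan.Hom.inr))
      (g.op.lan ⋙ presheafToSheaf K (Type w)) from
    preservesLimit_of_iso_diagram _ (diagramIsoCospan F).symm
  generalize F.map WalkingCospan.Hom.inl = φ
  generalize F.map WalkingCospan.Hom.inr = ψ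
  have h1 := isIso_map_pullbackComparison K g J₀ φ ψ
  have h2 : pullbackComparison (g.op.lan ⋙ presheafToSheaf K (Type w)) φ ψ =
      (presheafToSheaf K (Type w)).map (pullbackComparison g.op.lan φ ψ) ≫
        pullbackComparison (presheafToSheaf K (Type w)) _ _ := by
    apply pullback.hom_ext
    · rw [Category.assoc, pullbackComparison_comp_fst]
      erw [pullbackComparison_comp_fst]
      rw [← Functor.map_comp, pullbackComparison_comp_fst]
      rfl
    · rw [Category.assoc, pullbackComparison_comp_snd]
      erw [pullbackComparison_comp_snd]
      rw [← Functor.map_comp, pullbackComparison_comp_snd]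
      rfl
  have : IsIso (pullbackComparison (g.op.lan ⋙ presheafToSheaf K (Type w)) φ ψ) := by
    rw [h2]
    exact IsIso.comp_isIso
  exact PreservesPullback.of_iso_comparison _

theorem lan_lex (J₀ : GrothendieckTopology C₀) [IsMorphismOfSites J₀ K g]
    [IsSmallGenerated K] :
    PreservesFiniteLimits (g.op.lan ⋙ presheafToSheaf K (Type w)) := by
  have := preservesTerminal K g J₀
  have := preservesPullback K g J₀
  have : PreservesLimitsOfShape (Discrete PEmpty.{1}) (g.op.lan ⋙ presheafToSheaf K (Type w)) :=
    preservesLimitsOfShape_pempty_of_preservesTerminal _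
  exact preservesFiniteLimits_of_preservesTerminal_and_pullbacks _

end Lan


theorem isMorphismOfSites_of_dense {C₀ : Type w} [SmallCategory C₀] (i : C₀ ⥤ C) [i.Full]
    [i.Faithful] [i.IsCoverDense J] : IsMorphismOfSites (i.restrictedTopology J) J i where
  factorSieve_mem I _ _ X c := by
    refine J.superset_covering ?_ (i.is_cover_of_isCoverDense J c.pt)
    rintro V w ⟨⟨W, l, m, fac⟩⟩
    refine ⟨⟨W, ⟨fun j => i.preimage (m ≫ c.π.app j), fun j j' φ => ?_⟩⟩, l, fun j => ?_⟩
    · apply i.map_injective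
      have := c.w φ
      simpa using congr_arg (m ≫ ·) this.symm
    · simp [← fac]
  coverPreserving := i.coverPreserving_restrictedTopology J

theorem isMorphismOfSites_comp {C₀ : Type u₃} [Category.{w} C₀] (J₀ : GrothendieckTopology C₀)
    (i : C₀ ⥤ C) [IsMorphismOfSites J₀ J i] [IsMorphismOfSites J K f] :
    IsMorphismOfSites J₀ K (i ⋙ f) where
  factorSieve_mem I _ _ X c := by
    let c' : Cone ((X ⋙ i) ⋙ f) := ⟨c.pt, c.π⟩
    refine K.transitive (IsMorphismOfSites.factorSieve_mem J I (X ⋙ i) c') _ ?_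
    rintro d' w ⟨a, u, h⟩
    have h1 := (IsMorphismOfSites.coverPreserving (K := K) (f := f)).cover_preserve
      (IsMorphismOfSites.factorSieve_mem (K := J) (f := i) J₀ I X a)
    refine K.superset_covering ?_ (K.pullback_stable u h1)
    rintro d'' w' ⟨e, s, v, ⟨b, u', h'⟩, fac⟩
    refine ⟨b, v ≫ f.map u', fun j => ?_⟩
    have h2 : u ≫ f.map (a.π.app j) = w ≫ c.π.app j := h j
    have h3 : u' ≫ i.map (b.π.app j) = s ≫ a.π.app j := h' j
    simp only [Functor.comp_map, Category.assoc]
    rw [← f.map_comp, h3, f.map_comp, ← reassoc_of% fac, h2]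
  coverPreserving := CoverPreserving.comp _ _ (IsMorphismOfSites.coverPreserving)
    (IsMorphismOfSites.coverPreserving (J := J))

/-- For a morphism of sites `f`, restriction of sheaves along `f` has a lex left adjoint. -/
theorem exists_leftAdjoint [IsSmallGenerated J] [IsSmallGenerated K] [IsMorphismOfSites J K f] :
    ∃ (L : Sheaf J (Type w) ⥤ Sheaf K (Type w)),
      Nonempty (L ⊣ f.sheafPushforwardContinuous (Type w) J K) ∧ PreservesFiniteLimits L := by
  obtain ⟨C₀, _, i, _, _, _⟩ := IsSmallGenerated.exists_dense (J := J)
  let J₀ := i.restrictedTopology J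
  have h1 : IsMorphismOfSites J₀ J i := isMorphismOfSites_of_dense J i
  have h2 : IsMorphismOfSites J₀ K (i ⋙ f) := isMorphismOfSites_comp J K f J₀ i
  let e := Functor.IsDenseSubsite.sheafEquiv J₀ J i (Type w)
  have := lan_lex K (i ⋙ f) J₀
  let L₀ := Functor.sheafPullbackConstruction.sheafPullback (i ⋙ f) (Type w) J₀ K
  have hL₀ : PreservesFiniteLimits L₀ :=
    comp_preservesFiniteLimits (sheafToPresheaf J₀ (Type w)) _
  let adj₀ : L₀ ⊣ (i ⋙ f).sheafPushforwardContinuous (Type w) J₀ K :=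
    Functor.sheafPullbackConstruction.sheafAdjunctionContinuous (i ⋙ f) (Type w) J₀ K
  refine ⟨e.inverse ⋙ L₀, ⟨(e.symm.toAdjunction.comp adj₀).ofNatIsoRight ?_⟩,
    comp_preservesFiniteLimits _ _⟩
  exact Functor.isoWhiskerLeft (f.sheafPushforwardContinuous (Type w) J K) e.counitIso ≪≫
    Functor.rightUnitor _

instance [IsSmallGenerated J] [IsSmallGenerated K] [IsMorphismOfSites J K f] :
    (f.sheafPushforwardContinuous (Type w) J K).IsRightAdjoint := by
  obtain ⟨L, ⟨adj⟩, _⟩ := exists_leftAdjoint J K f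
  exact adj.isRightAdjoint

instance [IsSmallGenerated J] [IsSmallGenerated K] [IsMorphismOfSites J K f] :
    PreservesFiniteLimits (f.sheafPullback (Type w) J K) := by
  obtain ⟨L, ⟨adj⟩, _⟩ := exists_leftAdjoint J K f
  exact preservesFiniteLimits_of_natIso
    (adj.leftAdjointUniq (f.sheafAdjunctionContinuous (Type w) J K))

/-- The functor `C_f^*` induced by a comorphism of sites: restrict along `f`, then sheafify. -/
noncomputable def comorphismInverse [IsSmallGenerated J] : Sheaf K (Type w) ⥤ Sheaf J (Type w) :=
  sheafToPresheaf K (Type w) ⋙ (Functor.whiskeringLeft _ _ _).obj f.op ⋙ presheafToSheaf J (Type w)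

instance [IsSmallGenerated J] : PreservesFiniteLimits (comorphismInverse J K f) := by
  have : PreservesFiniteLimits ((Functor.whiskeringLeft _ _ (Type w)).obj f.op) := inferInstance
  have : PreservesFiniteLimits ((Functor.whiskeringLeft _ _ _).obj f.op ⋙ presheafToSheaf J (Type w)) :=
    comp_preservesFiniteLimits _ _
  exact comp_preservesFiniteLimits (sheafToPresheaf K (Type w)) _

instance [IsSmallGenerated J] [f.IsCocontinuous J K] : (comorphismInverse J K f).IsLeftAdjoint := by
  obtain ⟨C₀, _, i, _, _, _⟩ := IsSmallGenerated.exists_dense (J := J)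
  let J₀ := i.restrictedTopology J
  let e := Functor.IsDenseSubsite.sheafEquiv J₀ J i (Type w)
  have h1 : (i ⋙ f).IsCocontinuous J₀ K := isCocontinuous_comp i f J₀ J
  let F₀ : Sheaf K (Type w) ⥤ Sheaf J₀ (Type w) := sheafToPresheaf K (Type w) ⋙
    (Functor.whiskeringLeft _ _ _).obj (i ⋙ f).op ⋙ presheafToSheaf J₀ (Type w)
  let adj : F₀ ⊣ (i ⋙ f).sheafPushforwardCocontinuous (Type w) J₀ K :=
    (((i ⋙ f).op.ranAdjunction (Type w)).comp
      (sheafificationAdjunction J₀ (Type w))).restrictFullyFaithful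
      (fullyFaithfulSheafToPresheaf K (Type w)) (Functor.FullyFaithful.id _) (Iso.refl _)
      (Iso.refl _)
  have : F₀.IsLeftAdjoint := adj.isLeftAdjoint
  have iso : F₀ ⋙ e.functor ≅ comorphismInverse J K f :=
    Functor.isoWhiskerLeft (sheafToPresheaf K (Type w) ⋙
      (Functor.whiskeringLeft _ _ _).obj f.op)
      (Functor.isoWhiskerRight (Functor.IsDenseSubsite.sheafEquivSheafificationCompatibility J₀ J i
        (Type w)) e.functor ≪≫ Functor.isoWhiskerLeft (presheafToSheaf J (Type w)) e.counitIso ≪≫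
          Functor.rightUnitor _)
  have : (F₀ ⋙ e.functor).IsLeftAdjoint := inferInstance
  exact Functor.isLeftAdjoint_of_iso iso


section Geometric

universe v v' u u'

/-- A geometric morphism `E → F`: an adjunction `inverse ⊣ direct` with `inverse` lex. -/
structure GeometricMorphism (E : Type u) [Category.{v} E] (F : Type u') [Category.{v'} F] where
  direct : E ⥤ F
  inverse : F ⥤ E
  adj : inverse ⊣ direct
  lex : PreservesFiniteLimits inverse

variable {E : Type u} [Category.{v} E] {F : Type u'} [Category.{v'} F]

/-- A left adjoint `L` of the inverse image `p^*` is *`F`-indexed* if transposition turns every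
pullback square `A' = A ×_{p^* I} p^* I'` in `E` into a pullback square
`L A' = L A ×_I I'` in `F`. The morphism `p` is locally connected when `p^*` has an indexed left
adjoint. -/
def GeometricMorphism.IsIndexed (p : GeometricMorphism E F) {L : E ⥤ F} (adj : L ⊣ p.inverse) :
    Prop :=
  ∀ ⦃A A' : E⦄ ⦃I I' : F⦄ (v : A' ⟶ A) (a' : A' ⟶ p.inverse.obj I') (a : A ⟶ p.inverse.obj I)
    (u : I' ⟶ I), IsPullback v a' a (p.inverse.map u) →
      IsPullback (L.map v) ((adj.homEquiv A' I').symm a') ((adj.homEquiv A I).symm a) u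

/-- `p` is *totally connected*: it is locally connected, and the (indexed) left adjoint of its
inverse image preserves finite limits. -/
def GeometricMorphism.IsTotallyConnected (p : GeometricMorphism E F) : Prop :=
  ∃ (L : E ⥤ F) (adj : L ⊣ p.inverse), p.IsIndexed adj ∧ PreservesFiniteLimits L

/-- A section of `p : E → F`: a geometric morphism `F → E` whose composite with `p` is identified
with the identity of `F` (through inverse images). -/
structure GeometricMorphism.Section (p : GeometricMorphism E F) where
  toGeom : GeometricMorphism F E
  iso : p.inverse ⋙ toGeom.inverse ≅ 𝟭 F

/-- A morphism of sections is a geometric transformation, that is a natural transformation of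
inverse images `s^* ⟶ t^*`, over the identity of `F`. -/
@[ext]
structure GeometricMorphism.Section.Hom {p : GeometricMorphism E F} (s t : p.Section) where
  trans : s.toGeom.inverse ⟶ t.toGeom.inverse
  comm : Functor.whiskerLeft p.inverse trans ≫ t.iso.hom = s.iso.hom

instance (p : GeometricMorphism E F) : Category p.Section where
  Hom := GeometricMorphism.Section.Hom
  id s := ⟨𝟙 _, by simp⟩
  comp α β := ⟨α.trans ≫ β.trans, by
    rw [Functor.whiskerLeft_comp, Category.assoc, β.comm, α.comm]⟩

/-- `s` is, for some identification `p ∘ s ≅ 1`, a terminal object of the category of sections. -/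
def GeometricMorphism.IsTerminalSection (p : GeometricMorphism E F) (s : GeometricMorphism F E) :
    Prop :=
  ∃ α : p.inverse ⋙ s.inverse ≅ 𝟭 F, Nonempty (IsTerminal (⟨s, α⟩ : p.Section))

end Geometric

/-- The geometric morphism `Sh(f) : Sh(D, K) → Sh(C, J)` of a morphism of sites `f`; its direct image
is restriction along `f`. -/
noncomputable def Sh [IsSmallGenerated J] [IsSmallGenerated K] [IsMorphismOfSites J K f] :
    GeometricMorphism (Sheaf K (Type w)) (Sheaf J (Type w)) where
  direct := f.sheafPushforwardContinuous (Type w) J K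
  inverse := f.sheafPullback (Type w) J K
  adj := f.sheafAdjunctionContinuous (Type w) J K
  lex := inferInstance

/-- The geometric morphism `C_f : Sh(C, J) → Sh(D, K)` of a comorphism of sites `f`; its inverse
image is restriction along `f` followed by sheafification, its direct image the right adjoint of
that (restriction of the right Kan extension). -/
noncomputable def Co [IsSmallGenerated J] [f.IsCocontinuous J K] :
    GeometricMorphism (Sheaf J (Type w)) (Sheaf K (Type w)) where
  direct := (comorphismInverse J K f).rightAdjoint
  inverse := comorphismInverse J K f
  adj := Adjunction.ofIsLeftAdjoint _
  lex := inferInstance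

section Squares

variable {A : Type u₃} [Category.{w} A] {B : Type u₄} [Category.{w} B]
  (M : GrothendieckTopology A) (L : GrothendieckTopology B)
  (J : GrothendieckTopology C) (K : GrothendieckTopology D)
  {t : A ⥤ B} {G : A ⥤ C} {k : B ⥤ D} {h : C ⥤ D}
  [IsSmallGenerated M] [IsSmallGenerated L] [IsSmallGenerated J] [IsSmallGenerated K]
  [IsMorphismOfSites M L t] [IsMorphismOfSites J K h]
  [G.IsCocontinuous M J] [k.IsCocontinuous L K]

/-- For a square `φ : k t ⟶ h G` (with `t`, `h` morphisms and `G`, `k` comorphisms of sites), the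
2-cell `C_G^* Sh(h)_* ⟶ Sh(t)_* C_k^*` induced by restriction along `φ`: at a sheaf `Y` it
corresponds, under the sheafification adjunction, to
`Y(h G -) ⟶ Y(k t -) ⟶ (a_L (Y k))(t -)`. -/
noncomputable def restCell (φ : t ⋙ k ⟶ G ⋙ h) :
    (Sh J K h).direct ⋙ (Co M J G).inverse ⟶ (Co L K k).inverse ⋙ (Sh M L t).direct where
  app Y := ((sheafificationAdjunction M (Type w)).homEquiv (G.op ⋙ h.op ⋙ Y.obj)
      ((t.sheafPushforwardContinuous (Type w) M L).obj
        ((presheafToSheaf L (Type w)).obj (k.op ⋙ Y.obj)))).symm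
    (Functor.whiskerRight (NatTrans.op φ) Y.obj ≫
      Functor.whiskerLeft t.op (toSheafify L (k.op ⋙ Y.obj)))
  naturality Y Y' α := by
    apply ((sheafificationAdjunction M (Type w)).homEquiv _ _).injective
    change ((sheafificationAdjunction M (Type w)).homEquiv _ _)
        ((presheafToSheaf M (Type w)).map (Functor.whiskerLeft G.op
          (Functor.whiskerLeft h.op α.hom)) ≫ _) =
      ((sheafificationAdjunction M (Type w)).homEquiv _ _) (_ ≫
        (t.sheafPushforwardContinuous (Type w) M L).map ((presheafToSheaf L (Type w)).map
          (Functor.whiskerLeft k.op α.hom)))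
    rw [Adjunction.homEquiv_naturality_left, Adjunction.homEquiv_naturality_right,
      Equiv.apply_symm_apply, Equiv.apply_symm_apply]
    have h1 : toSheafify L (k.op ⋙ Y.obj) ≫
        ((presheafToSheaf L (Type w)).map (Functor.whiskerLeft k.op α.hom)).hom =
        Functor.whiskerLeft k.op α.hom ≫ toSheafify L (k.op ⋙ Y'.obj) :=
      (toSheafify_naturality L (Functor.whiskerLeft k.op α.hom)).symm
    apply NatTrans.ext
    funext X
    have h2 := NatTrans.congr_app h1 (op (t.obj X.unop))
    have h3 := α.hom.naturality (φ.app X.unop).op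
    change α.hom.app (op (h.obj (G.obj X.unop))) ≫ Y'.obj.map (φ.app X.unop).op ≫
        (toSheafify L (k.op ⋙ Y'.obj)).app (op (t.obj X.unop)) =
      (Y.obj.map (φ.app X.unop).op ≫ (toSheafify L (k.op ⋙ Y.obj)).app (op (t.obj X.unop))) ≫
        ((presheafToSheaf L (Type w)).map (Functor.whiskerLeft k.op α.hom)).hom.app
          (op (t.obj X.unop))
    rw [Category.assoc]
    refine Eq.trans ?_ (congr_arg (Y.obj.map (φ.app X.unop).op ≫ ·) h2.symm)
    change _ = Y.obj.map (φ.app X.unop).op ≫ α.hom.app (op (k.obj (t.obj X.unop))) ≫ _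
    rw [← Category.assoc, ← Category.assoc]
    congr 1
    exact h3.symm

/-- The mate `Sh(t)^* C_G^* ⟶ C_k^* Sh(h)^*` of the previous cell under the adjunctions
`Sh(h)^* ⊣ Sh(h)_*` and `Sh(t)^* ⊣ Sh(t)_*`: whisker with the unit for `h`, apply `restCell`, and
whisker with the counit for `t`. It is the sheafification of the presheaf 2-cell
`lext_t rest_G ⟶ rest_k lext_h` given by the unit for `h`, restriction along `φ`, and the counit for
`t`. -/
noncomputable def cell (φ : t ⋙ k ⟶ G ⋙ h) :
    (Co M J G).inverse ⋙ (Sh M L t).inverse ⟶ (Sh J K h).inverse ⋙ (Co L K k).inverse :=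
  ((mateEquiv (Sh J K h).adj (Sh M L t).adj).symm (TwoSquare.mk _ _ _ _ (restCell M L J K φ))).natTrans

/-- The square `φ` is *locally exact* (`L`-locally exact, for the topology `L` of the target of `t`):
its induced 2-cell is invertible, `Sh(t)^* C_G^* ≅ C_k^* Sh(h)^*`. -/
def IsLocallyExact (φ : t ⋙ k ⟶ G ⋙ h) : Prop := IsIso (cell M L J K φ)

end Squares

end SiteTopos

open SiteTopos

/-! Everything reduces to one condition: that the counit of `Sh(f)^* ⊣ Sh(f)_*` is invertible. Since
`f` is a morphism of sites, restriction along `f` already lands in sheaves, so the sheafification in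
`C_f^*` changes nothing and `C_f^* ≅ Sh(f)_*` (`directIsoInverse`). Hence `C_f^*` always has a left
adjoint, namely `Sh(f)^*`, and that left adjoint is lex. Total connectedness therefore only asks
that this adjunction be indexed.

For a lex left adjoint of an inverse image, being indexed is the same as having an invertible counit
(`isTotallyConnected_iff_isIso_counit`). In one direction, indexedness is tested on the square over
`I ⟶ 1`. In the other, the left adjoint preserves the given pullback and the counit identifies `L
p^* I` with `I`.

For the identity square, the mate is a composite of the unit for `1_D`, a restriction cell and the
counit for `f`. The first two are invertible, so local exactness is invertibility of the same counit
(`isLocallyExact_iff_isIso_counit`).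

Once the counit is invertible, it exhibits `Sh(f)` as a section of `C_f`. The unit and the triangle
identities then show that this section is terminal. -/

namespace SiteTopos

/-! ### Geometric morphisms whose inverse image has a lex left adjoint -/

section Abstract

universe v v' u u'

variable {E : Type u} [Category.{v} E] {F : Type u'} [Category.{v'} F]
  (p : GeometricMorphism E F)

/-- A lex left adjoint of `p^*` is indexed as soon as `p^*` is fully faithful. -/
theorem GeometricMorphism.isIndexed_of_isIso_counit {L : E ⥤ F} (adj : L ⊣ p.inverse)
    [PreservesFiniteLimits L] [IsIso adj.counit] : p.IsIndexed adj := by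
  intro A A' I I' v a' a u h
  have h1 := h.map L
  -- A transpose is `L` of the map followed by the counit, so correcting the two corners `L p^* I'`
  -- and `L p^* I` by the counit turns the image square into the required one.
  refine h1.of_iso (Iso.refl _) (Iso.refl _) (asIso (adj.counit.app I'))
    (asIso (adj.counit.app I)) (by simp) ?_ ?_ ?_
  · simp [Adjunction.homEquiv_counit]
  · simp [Adjunction.homEquiv_counit]
  · simp

/-- Over `I ⟶ 1`, the square on `p^* I ⟶ p^* 1` with identities as its other sides is a pullback.
Its transpose exhibits the counit at `I` as a pullback of the counit at `1`. The latter is a map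
between terminal objects, because `p^*` and `L` are both lex. -/
theorem GeometricMorphism.IsIndexed.isIso_counit {p : GeometricMorphism E F} [HasTerminal F]
    {L : E ⥤ F} {adj : L ⊣ p.inverse} (h : p.IsIndexed adj) [PreservesFiniteLimits L] :
    IsIso adj.counit := by
  have := p.lex
  rw [NatTrans.isIso_iff_isIso_app]
  intro I
  have ht : IsTerminal (p.inverse.obj (⊤_ F)) := terminalIsTerminal.isTerminalObj _ _
  have hL : IsTerminal (L.obj (p.inverse.obj (⊤_ F))) := ht.isTerminalObj _ _
  have h1 := h (p.inverse.map (terminal.from I)) (𝟙 _) (𝟙 _) (terminal.from I)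
    (IsPullback.id_horiz _).flip
  have h2 : IsIso ((adj.homEquiv _ _).symm (𝟙 (p.inverse.obj (⊤_ F)))) :=
    isIso_of_isTerminal hL terminalIsTerminal _
  have h3 := h1.isIso_snd_of_isIso
  simpa [Adjunction.homEquiv_counit] using h3

/-- Invertibility of the counit depends only on the right adjoint, up to isomorphism. -/
theorem isIso_counit_iff_of_iso {L L' : E ⥤ F} {R R' : F ⥤ E} (adj : L ⊣ R) (adj' : L' ⊣ R')
    (e : R ≅ R') : IsIso adj.counit ↔ IsIso adj'.counit := by
  refine ⟨fun _ => ?_, fun _ => ?_⟩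
  · have := adj.fullyFaithfulROfIsIsoCounit.full
    -- The counit is invertible exactly when the right adjoint is fully faithful, a property that
    -- passes along `e`.
    have := adj.fullyFaithfulROfIsIsoCounit.faithful
    have := Functor.Full.of_iso (F := R) e
    have := Functor.Faithful.of_iso (F := R) e
    infer_instance
  · have := adj'.fullyFaithfulROfIsIsoCounit.full
    have := adj'.fullyFaithfulROfIsIsoCounit.faithful
    have := Functor.Full.of_iso (F := R') e.symm
    have := Functor.Faithful.of_iso (F := R') e.symm
    infer_instance

/-- The left adjoint provided by total connectedness need not be the given `L`, but invertibility of
the counit depends only on `p^*`, so the criterion can be tested on any lex left adjoint. -/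
theorem GeometricMorphism.isTotallyConnected_iff_isIso_counit [HasTerminal F] {L : E ⥤ F}
    (adj : L ⊣ p.inverse) [PreservesFiniteLimits L] :
    p.IsTotallyConnected ↔ IsIso adj.counit := by
  refine ⟨?_, fun _ => ⟨L, adj, p.isIndexed_of_isIso_counit adj, inferInstance⟩⟩
  rintro ⟨L', adj', h, _⟩
  have := h.isIso_counit
  exact (isIso_counit_iff_of_iso adj' adj (Iso.refl _)).1 this

/-- The counit serves as the identification `s^* p^* ≅ 1`. For any section `t`, the unit gives `t^*
⟶ t^* p^* s^* ≅ s^*`. One triangle identity makes this a morphism of sections; the other forces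
uniqueness. -/
theorem GeometricMorphism.isTerminalSection_of_isIso_counit (s : GeometricMorphism F E)
    (adj : s.inverse ⊣ p.inverse) [IsIso adj.counit] : p.IsTerminalSection s := by
  refine ⟨asIso adj.counit, ⟨IsTerminal.ofUniqueHom (fun t => ?_) ?_⟩⟩
  · refine ⟨(Functor.rightUnitor _).inv ≫ Functor.whiskerRight adj.unit t.toGeom.inverse ≫
      (Functor.associator _ _ _).hom ≫ Functor.whiskerLeft s.inverse t.iso.hom ≫
      (Functor.rightUnitor _).hom, ?_⟩
    ext Y
    have h := t.iso.hom.naturality (adj.counit.app Y)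
    dsimp at h ⊢
    simp only [Category.id_comp, Category.comp_id, Category.assoc]
    -- Naturality of `t.iso` moves the counit inside `t^* p^*`, where it cancels against the unit.
    rw [← h, ← Functor.map_comp_assoc, adj.right_triangle_components]
    simp
  · intro t m
    apply GeometricMorphism.Section.Hom.ext
    ext X
    have h1 := NatTrans.congr_app m.comm (s.inverse.obj X)
    have h2 := m.trans.naturality (adj.unit.app X)
    dsimp at h1 h2 ⊢
    simp only [Category.id_comp, Category.comp_id]
    -- Compatibility of `m` at `s^* X` rewrites `t.iso` as `m` followed by the counit. Naturality of
    -- `m` along the unit then leaves `m` at `X` followed by a triangle composite.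
    rw [← h1, reassoc_of% h2, adj.left_triangle_components]
    simp

end Abstract

/-! ### Comparison of `Sh(f)` with `C_f`, and the identity functor -/

variable {C : Type u₁} [Category.{w} C] {D : Type u₂} [Category.{w} D]
  (J : GrothendieckTopology C) (K : GrothendieckTopology D)

/-- When restriction along `f` preserves sheaves, the inverse image of `C_f` is the direct image of
`Sh(f)`: no sheafification is needed. -/
noncomputable def directIsoInverse (f : C ⥤ D) [IsSmallGenerated J] [IsSmallGenerated K]
    [IsMorphismOfSites J K f] [f.IsCocontinuous J K] :
    (Sh J K f).direct ≅ (Co J K f).inverse :=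
  (Functor.isoWhiskerLeft (f.sheafPushforwardContinuous (Type w) J K)
    (asIso (sheafificationAdjunction J (Type w)).counit)).symm

/-- The adjunction `Sh(f)^* ⊣ C_f^*`. -/
noncomputable def inverseAdjunction (f : C ⥤ D) [IsSmallGenerated J] [IsSmallGenerated K]
    [IsMorphismOfSites J K f] [f.IsCocontinuous J K] :
    (Sh J K f).inverse ⊣ (Co J K f).inverse :=
  (Sh J K f).adj.ofNatIsoRight (directIsoInverse J K f)

/-- The chosen functors for `1` are only isomorphic to the identity where they involve a chosen
adjoint or sheafification. Knowing that they are equivalences is enough to discard the identity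
sides of the square. -/
instance [IsSmallGenerated J] : (Sh J J (𝟭 C)).direct.IsEquivalence :=
  Functor.isEquivalence_of_iso
    (show 𝟭 (Sheaf J (Type w)) ≅ (Sh J J (𝟭 C)).direct from Iso.refl _)

instance [IsSmallGenerated J] : (Sh J J (𝟭 C)).inverse.IsEquivalence :=
  (Sh J J (𝟭 C)).adj.isEquivalence_left_of_isEquivalence_right

instance [IsSmallGenerated J] : (Co J J (𝟭 C)).inverse.IsEquivalence :=
  Functor.isEquivalence_of_iso (directIsoInverse J J (𝟭 C))

/-! ### The 2-cell of the identity square -/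

variable (f : C ⥤ D) [IsSmallGenerated J] [IsSmallGenerated K]
    [IsMorphismOfSites J K f] [f.IsCocontinuous J K]

/-- Restriction along an identity is invertible, and so is the sheafification map of `Y`, which is
already a sheaf. The cell is the transpose of their composite: its sheafification, followed by the
sheafification counit at a sheaf. -/
instance isIso_restCell :
    IsIso (restCell J K K K (t := f) (G := f) (k := 𝟭 D) (h := 𝟭 D) (𝟙 (f ⋙ 𝟭 D))) := by
  rw [NatTrans.isIso_iff_isIso_app]
  intro Y
  have h1 : IsIso (toSheafify K ((𝟭 D).op ⋙ Y.obj)) := isIso_toSheafify K Y.property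
  have h2 : IsIso (Functor.whiskerRight (NatTrans.op (𝟙 (f ⋙ 𝟭 D))) Y.obj) := inferInstance
  have h3 : IsIso (f.op.whiskerLeft (toSheafify K ((𝟭 D).op ⋙ Y.obj))) := inferInstance
  have h4 : IsIso (Functor.whiskerRight (NatTrans.op (𝟙 (f ⋙ 𝟭 D))) Y.obj ≫
      f.op.whiskerLeft (toSheafify K ((𝟭 D).op ⋙ Y.obj))) := IsIso.comp_isIso' h2 h3
  dsimp only [restCell]
  rw [Adjunction.homEquiv_counit]
  have h5 : ∀ Z : Sheaf J (Type w), IsIso ((sheafificationAdjunction J (Type w)).counit.app Z) :=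
    fun Z => inferInstance
  exact IsIso.comp_isIso' (@Functor.map_isIso _ _ _ _ _ _ (presheafToSheaf J (Type w)) _ h4) (h5 _)

theorem isLocallyExact_iff_isIso_counit :
    IsLocallyExact J K K K (t := f) (G := f) (k := 𝟭 D) (h := 𝟭 D) (𝟙 (f ⋙ 𝟭 D)) ↔
      IsIso (Sh J K f).adj.counit := by
  have key : ∀ X, (cell J K K K (t := f) (G := f) (k := 𝟭 D) (h := 𝟭 D) (𝟙 (f ⋙ 𝟭 D))).app X =
      (Sh J K f).inverse.map ((Co J K f).inverse.map ((Sh K K (𝟭 D)).adj.unit.app X)) ≫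
      (Sh J K f).inverse.map ((restCell J K K K (t := f) (G := f) (k := 𝟭 D) (h := 𝟭 D)
        (𝟙 (f ⋙ 𝟭 D))).app ((Sh K K (𝟭 D)).inverse.obj X)) ≫
      (Sh J K f).adj.counit.app
        ((Co K K (𝟭 D)).inverse.obj ((Sh K K (𝟭 D)).inverse.obj X)) := by
    intro X
    simp [cell, mateEquiv]
  have key' : ∀ X, IsIso ((cell J K K K (t := f) (G := f) (k := 𝟭 D) (h := 𝟭 D)
      (𝟙 (f ⋙ 𝟭 D))).app X) ↔ IsIso ((Sh J K f).adj.counit.app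
        ((Co K K (𝟭 D)).inverse.obj ((Sh K K (𝟭 D)).inverse.obj X))) := by
    intro X
    -- The unit for `1_D` is invertible because its left adjoint is an equivalence, and the middle
    -- factor is invertible by `isIso_restCell`; only the counit for `f` remains.
    rw [key, isIso_comp_left_iff, isIso_comp_left_iff]
  rw [IsLocallyExact, NatTrans.isIso_iff_isIso_app, NatTrans.isIso_iff_isIso_app]
  simp only [key']
  refine ⟨fun h Y => ?_, fun h X => h _⟩
  -- The cell tests the counit only at objects in the image of `e`. As `e` is an equivalence, every
  -- sheaf is isomorphic to one of these.
  let e := (Sh K K (𝟭 D)).inverse ⋙ (Co K K (𝟭 D)).inverse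
  exact (NatTrans.isIso_app_iff_of_iso (Sh J K f).adj.counit (e.objObjPreimageIso Y)).1 (h _)

end SiteTopos

open SiteTopos
theorem mainTheorem8 {C : Type u₁} [Category.{w} C] {D : Type u₂} [Category.{w} D]
    (J : GrothendieckTopology C) (K : GrothendieckTopology D)
    [IsSmallGenerated J] [IsSmallGenerated K] (f : C ⥤ D)
    [IsMorphismOfSites J K f] [f.IsCocontinuous J K] :
    ((Co J K f).IsTotallyConnected ↔
      IsLocallyExact J K K K (t := f) (G := f) (k := 𝟭 D) (h := 𝟭 D) (𝟙 (f ⋙ 𝟭 D))) ∧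
    ((Co J K f).IsTotallyConnected → (Co J K f).IsTerminalSection (Sh J K f)) := by
  have := (Sh J K f).lex
  have h := (Co J K f).isTotallyConnected_iff_isIso_counit (inverseAdjunction J K f)
  refine ⟨?_, fun h' => ?_⟩
  · rw [h, isLocallyExact_iff_isIso_counit]
    -- The two sides involve counits of different adjunctions, with right adjoints `C_f^*` and
    -- `Sh(f)_*`; the isomorphism between these right adjoints reconciles them.
    exact (isIso_counit_iff_of_iso _ _ (directIsoInverse J K f)).symm
  · have := h.1 h'
    exact (Co J K f).isTerminalSection_of_isIso_counit _ (inverseAdjunction J K f)
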